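/- Let $\sigma_1,\sigma_2$ be the standard generators of the braid group $B_3$ on three strands, with the convention that, when all strands are oriented in parallel, $\sigma_1$ and $\sigma_2$ are negative crossings, and let $C=(\sigma_1\sigma_2\sigma_1)^2$ be the full twist. For an oriented link $K$ with diagram $D$ of writhe $w(D)$, let $$J_K(t)=(-A)^{-3w(D)}\langle D\rangle\Big|_{A=t^{-1/4}}$$ be its Jones polynomial, where $\langle D\rangle$ is the Kauffman bracket normalized to be $1$ on the crossingless diagram of the unknot. Write $$J_K(t)=\alpha_K t^{M}+\beta_K t^{M-1}+\cdots+\beta'_K t^{m+1}+\alpha'_K t^{m},$$ where $M$ and $m$ are the highest and the lowest power of $t$ occurring in $J_K(t)$, so that $\alpha_K,\alpha'_K\neq 0$; $\beta_K$ and $\beta'_K$ are called the second and the next-to-last coefficient. Then for every integer $s>1$ there are an integer $k$ and positive integers $p_1,q_1,\dots,p_s,q_s$ such that the closure $K=K_s$ of the 3-braid word $$b=C^k\sigma_1^{p_1}\sigma_2^{-q_1}\cdots\sigma_1^{p_s}\sigma_2^{-q_s}$$ is a knot whose Jones polynomial satisfies $$\beta_K=-\frac{s(s+3)}{2}+1,\qquad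 \beta'_K=s.$$ -/

import Mathlib

open scoped LaurentPolynomial

/-- Words in the Artin generators of the braid group on `n + 1` strands. The letter `(i, true)`
is `σ_{i+1}` and the letter `(i, false)` is `σ_{i+1}⁻¹`; both exchange the strands in the
positions `i` and `i + 1` (positions are counted from `0`). All strands are oriented in parallel.
Convention: `σ_i` is a negative crossing, so that `σ_i⁻¹` is a positive crossing. -/
abbrev BraidWord (n : ℕ) : Type := List (Fin n × Bool)

namespace BraidWord

/-- The inverse word. -/
def inv {n : ℕ} (w : BraidWord n) : BraidWord n :=
  (w.map fun l => (l.1, !l.2)).reverse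

/-- The word `w` written `k` times in a row. -/
def npow {n : ℕ} (w : BraidWord n) (k : ℕ) : BraidWord n :=
  (List.replicate k w).flatten

/-- Integer powers of a word. -/
def zpow {n : ℕ} (w : BraidWord n) : ℤ → BraidWord n
  | Int.ofNat k => w.npow k
  | Int.negSucc k => w.inv.npow (k + 1)

/-- The permutation of the strand positions induced by a braid word. -/
def perm {n : ℕ} (w : BraidWord n) : Equiv.Perm (Fin (n + 1)) :=
  (w.map fun l => Equiv.swap l.1.castSucc l.1.succ).prod

/-- The closure of the braid word is a knot, that is, a link with exactly one component. The
components of the closure are the cycles of the induced permutation (fixed points included). -/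
def ClosureIsKnot {n : ℕ} (w : BraidWord n) : Prop :=
  ∀ i j : Fin (n + 1), w.perm.SameCycle i j

/-- The writhe of the closed braid diagram: the number of positive crossings minus the number of
negative crossings. -/
def writhe {n : ℕ} (w : BraidWord n) : ℤ :=
  (w.map fun l => if l.2 then (-1 : ℤ) else 1).sum

end BraidWord

/-- A crossing-free stack of layers on `n + 1` vertical strands. The layer `none` consists of
`n + 1` vertical segments. The layer `some i` consists of a horizontal arc joining the positions
`i` and `i + 1` on its initial side, another such arc on its terminal side, and vertical segments
in all the other positions. -/
abbrev FlatStack (n : ℕ) : Type := List (Option (Fin n))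

namespace FlatStack

/-- The arcs of the closed-up stack `L`. The marked point `(p, j)` is the point in the position
`p` between the layers number `j - 1` and `j`; the closing arcs join the end of each
position to its beginning. -/
inductive Arc {n : ℕ} (L : FlatStack n) :
    Fin (n + 1) × Fin (L.length + 1) → Fin (n + 1) × Fin (L.length + 1) → Prop
  | vertical (j : Fin L.length) (p : Fin (n + 1))
      (h : ∀ i : Fin n, L.get j = some i → p ≠ i.castSucc ∧ p ≠ i.succ) :
      Arc L (p, j.castSucc) (p, j.succ)
  | initial (j : Fin L.length) (i : Fin n) (h : L.get j = some i) :
      Arc L (i.castSucc, j.castSucc) (i.succ, j.castSucc)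
  | terminal (j : Fin L.length) (i : Fin n) (h : L.get j = some i) :
      Arc L (i.castSucc, j.succ) (i.succ, j.succ)
  | closing (p : Fin (n + 1)) : Arc L (p, Fin.last L.length) (p, 0)

/-- The number of circles in the closure of a stack: the number of connected components of the
union of its arcs. -/
noncomputable def circles {n : ℕ} (L : FlatStack n) : ℕ :=
  Nat.card (Quot (Arc L))

end FlatStack

namespace BraidWord

/-- The crossing-free stack obtained from a braid word by resolving the crossing number `j` by its
`A`-resolution if `S j = true`, and by its `B`-resolution otherwise. The `A`-resolution of a
positive crossing of two upward strands and the `B`-resolution of a negative one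
respect the orientation, and give vertical segments; the other two resolutions give horizontal
arcs. (The `A`-resolution joins the two regions swept out by the overstrand when it is turned
counterclockwise.) -/
def resolve {n : ℕ} (w : BraidWord n) (S : Fin w.length → Bool) : FlatStack n :=
  List.ofFn fun j => if S j = (w.get j).2 then some (w.get j).1 else none

/-- The Kauffman bracket of the closed braid diagram, as a Laurent polynomial in the variable `A`,
normalized to be `1` on a circle without crossings: the sum over all states of
`A ^ (#A - #B) * (-A² - A⁻²) ^ (#circles - 1)`. -/
noncomputable def kauffmanBracket {n : ℕ} (w : BraidWord n) : ℤ[T;T⁻¹] :=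
  ∑ S : Fin w.length → Bool,
    LaurentPolynomial.T (∑ j, if S j then (1 : ℤ) else -1) *
      (-LaurentPolynomial.T 2 - LaurentPolynomial.T (-2)) ^ ((w.resolve S).circles - 1)

/-- The bracket multiplied by `(-A) ^ (-3 * writhe)`. -/
noncomputable def normalizedBracket {n : ℕ} (w : BraidWord n) : ℤ[T;T⁻¹] :=
  LaurentPolynomial.C (((-3 * w.writhe).negOnePow : ℤˣ) : ℤ) *
    LaurentPolynomial.T (-3 * w.writhe) * w.kauffmanBracket

/-- The Jones polynomial of the closure of a braid word, in the variable `t` with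
`A = t ^ (-1/4)`. It is a finite integer combination of rational powers of `t`; the coefficient
of `t ^ r` is `w.jones.coeff r`. -/
noncomputable def jones {n : ℕ} (w : BraidWord n) : AddMonoidAlgebra ℤ ℚ :=
  w.normalizedBracket.mapDomain fun m : ℤ => -(m : ℚ) / 4

end BraidWord

/-- If `J = α t ^ M + β t ^ (M - 1) + ⋯` with `M` the highest power of `t` that occurs in `J`,
then `β` is the second coefficient of `J`. -/
def IsSecondCoeff (J : AddMonoidAlgebra ℤ ℚ) (β : ℤ) : Prop :=
  ∃ M : ℚ, IsGreatest {r : ℚ | J.coeff r ≠ 0} M ∧ J.coeff (M - 1) = β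

/-- If `J = ⋯ + β' t ^ (m + 1) + α' t ^ m` with `m` the lowest power of `t` that occurs in `J`,
then `β'` is the next-to-last coefficient of `J`. -/
def IsNextToLastCoeff (J : AddMonoidAlgebra ℤ ℚ) (β' : ℤ) : Prop :=
  ∃ m : ℚ, IsLeast {r : ℚ | J.coeff r ≠ 0} m ∧ J.coeff (m + 1) = β'

/-- The `3`-braid word `(σ₁ σ₂ σ₁)²`, a full twist on three strands. -/
def fullTwist : BraidWord 2 :=
  [(0, true), (1, true), (0, true), (0, true), (1, true), (0, true)]

/-- The generic `3`-braid word
`C ^ k σ₁ ^ (p 0) σ₂ ^ (-q 0) ⋯ σ₁ ^ (p (s-1)) σ₂ ^ (-q (s-1))`, with `C` the full twist. -/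
def genericWord {s : ℕ} (k : ℤ) (p q : Fin s → ℕ) : BraidWord 2 :=
  fullTwist.zpow k ++
    (List.ofFn fun i => List.replicate (p i) (0, true) ++ List.replicate (q i) (1, false)).flatten

/-! The bracket of a closed 3-braid of writhe `w` is `(A⁴ + A⁻⁴) A^w` (the abelian term) plus the
trace of a two-dimensional Temperley-Lieb representation (`kauffmanBracket_eq`). Up to scalars this
is the reduced Burau representation at `v = -A⁴ = -t⁻¹`. The full twist acts there as the scalar
`A⁶`, so `k` only shifts the trace against the abelian term.

A rescaled block `X^p Y^q` is easy to truncate at either end. Modulo `v³`, for `p, q ≥ 3`, it is a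
matrix of determinant zero and trace `1 + v + 2v²`; modulo `v⁻²`, for `p, q ≥ 2`, it is `diag(1 +
v⁻¹, 0)`. So for `s` blocks the trace begins like `(1 + v + 2v²)^s` at one end and `(1 + v⁻¹)^s` at
the other (`coeff_trace_low`, `coeff_trace_high`).

Take `p = q` with sum `P`. The lowest powers of `v` in the trace and in the abelian term agree
exactly when `P = 3k + 1`, and these terms cancel when `P` is odd. What remains is `1 + v² - (1 + v
+ 2v²)^s = -s v + (1 - s(s+3)/2) v² + ⋯`, which gives `β`. At the other end the abelian term is out
of reach, and `-(1 + v⁻¹)^s` with `v⁻¹ = -t` gives `β' = s`. The choice `k = 2s` with exponents `7,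
6, …, 6` meets these conditions, and its single odd block makes the permutation a 3-cycle. -/

/-! ### Counting circles by two-colourings. -/

namespace FlatStack

/-- Two colourings of the positions, on the initial and on the terminal side of a layer, are
compatible if they extend to a colouring of the layer that is constant on each arc. -/
def LayerCompat {n : ℕ} {α : Type*} (o : Option (Fin n)) (x y : Fin (n + 1) → α) : Prop :=
  (∀ p, (∀ i, o = some i → p ≠ i.castSucc ∧ p ≠ i.succ) → x p = y p) ∧
    ∀ i, o = some i → x i.castSucc = x i.succ ∧ y i.castSucc = y i.succ

instance {n : ℕ} {α : Type*} [DecidableEq α] (o : Option (Fin n)) (x y : Fin (n + 1) → α) :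
    Decidable (LayerCompat o x y) := by
  unfold LayerCompat; infer_instance

/-- The transfer matrix of a layer, acting on colourings of the positions with two colours. -/
def layerMatrix {n : ℕ} (o : Option (Fin n)) :
    Matrix (Fin (n + 1) → Fin 2) (Fin (n + 1) → Fin 2) ℤ :=
  Matrix.of fun x y => if LayerCompat o x y then 1 else 0

end FlatStack

theorem Matrix.list_map_prod_apply_eq_sum_paths {X ι R : Type*} [Fintype X] [DecidableEq X]
    [CommRing R] (M : ι → Matrix X X R) (L : List ι) (x y : X) :
    (L.map M).prod x y = ∑ g : Fin (L.length + 1) → X,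
      if g 0 = x ∧ g (Fin.last _) = y then
        ∏ j : Fin L.length, M (L.get j) (g j.castSucc) (g j.succ) else 0 := by
  induction L generalizing x with
  | nil =>
    refine Eq.symm (((Equiv.funUnique (Fin 1) X).symm.sum_comp _).symm.trans ?_)
    simp only [List.map_nil, List.prod_nil, Matrix.one_apply, List.length_nil,
      Finset.univ_eq_empty, Finset.prod_empty]
    rw [Finset.sum_eq_single x]
    · simp
    · intro b _ hb
      simp [hb]
    · simp
  | cons l L ih =>
    rw [List.map_cons, List.prod_cons, Matrix.mul_apply]
    simp only [ih]
    simp only [List.length_cons]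
    rw [← (Fin.consEquiv (fun _ : Fin (L.length + 2) => X)).sum_comp, Fintype.sum_prod_type]
    symm
    rw [Finset.sum_eq_single x]
    · simp only [Finset.mul_sum]
      symm
      rw [Finset.sum_comm]
      refine Finset.sum_congr rfl fun g _ => ?_
      rw [Finset.sum_eq_single (g 0)]
      · simp [Fin.consEquiv, Fin.prod_univ_succ, ← Fin.succ_last]
      · intro b _ hb
        simp [Ne.symm hb]
      · simp
    · intro b _ hb
      simp [Fin.consEquiv, hb]
    · simp

namespace FlatStack

theorem forall_arc_iff {n : ℕ} {α : Type*} (L : FlatStack n)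
    (f : Fin (n + 1) × Fin (L.length + 1) → α) :
    (∀ a b, Arc L a b → f a = f b) ↔
      (∀ j : Fin L.length, LayerCompat (L.get j) (fun p => f (p, j.castSucc))
        (fun p => f (p, j.succ))) ∧ (fun p => f (p, Fin.last _)) = fun p => f (p, 0) := by
  constructor
  · intro h
    refine ⟨fun j => ⟨fun p hp => h _ _ (.vertical j p hp), fun i hi =>
      ⟨h _ _ (.initial j i hi), h _ _ (.terminal j i hi)⟩⟩, funext fun p => h _ _ (.closing p)⟩
  · rintro ⟨h1, h2⟩ a b hab
    cases hab with
    | vertical j p hp => exact (h1 j).1 p hp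
    | initial j i hi => exact ((h1 j).2 i hi).1
    | terminal j i hi => exact ((h1 j).2 i hi).2
    | closing p => exact congrFun h2 p

/-- The functions on a quotient are the functions that respect the relation. -/
def quotFunEquiv {V α : Type*} (r : V → V → Prop) :
    (Quot r → α) ≃ {f : V → α // ∀ a b, r a b → f a = f b} where
  toFun := fun g => ⟨g ∘ Quot.mk r, fun _ _ h => congrArg g (Quot.sound h)⟩
  invFun f := Quot.lift f.1 f.2
  left_inv _ := funext fun x => Quot.inductionOn x fun _ => rfl
  right_inv _ := rfl

/-- A two-colouring that is constant on arcs is a function on the set of circles. Read level by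
level it is a closed path of position colourings, and a trace of transfer matrices counts such
paths. This makes the circle count multiplicative in the layers. -/
theorem two_pow_circles {n : ℕ} (L : FlatStack n) :
    (2 : ℤ) ^ L.circles = ((L.map layerMatrix).prod).trace := by
  classical
  have h1 : (2 : ℤ) ^ L.circles = (Nat.card (Quot (Arc L) → Fin 2) : ℤ) := by
    rw [Nat.card_fun]; simp [circles]
  rw [h1, Nat.card_congr (quotFunEquiv (Arc L)), Nat.card_congr (Equiv.subtypeEquivRight
    (forall_arc_iff L)), Nat.card_eq_fintype_card, Fintype.card_subtype, Finset.card_filter]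
  push_cast
  -- Colourings of the points (position, level) are reindexed as sequences of position colourings.
  rw [← ((Equiv.curry _ _ _).symm.trans
    ((Equiv.prodComm (Fin (L.length + 1)) (Fin (n + 1))).arrowCongr
      (Equiv.refl (Fin 2)))).sum_comp, Matrix.trace]
  simp only [Matrix.diag_apply, Matrix.list_map_prod_apply_eq_sum_paths]
  symm
  rw [Finset.sum_comm]
  refine Finset.sum_congr rfl fun g _ => ?_
  rw [Finset.sum_eq_single (g 0)]
  · by_cases hg : g (Fin.last _) = g 0
    · by_cases hc : ∀ j : Fin L.length, LayerCompat (L.get j) (g j.castSucc) (g j.succ)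
      · have hc' := hc
        simp only [List.get_eq_getElem] at hc'
        simp [Equiv.arrowCongr, Function.uncurry, Function.comp_def, hg, layerMatrix, hc']
      · have hc' := hc
        simp only [List.get_eq_getElem] at hc'
        obtain ⟨j, hj⟩ := not_forall.1 hc
        rw [if_pos ⟨rfl, hg⟩, Finset.prod_eq_zero (Finset.mem_univ j) (by simp only [layerMatrix,
          Matrix.of_apply, if_neg hj])]
        exact (if_neg fun h => hc h.1).symm
    · rw [if_neg (by simp [hg])]
      exact (if_neg fun h => hg h.2).symm
  · intro b _ hb
    simp [Ne.symm hb]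
  · simp

theorem layerMatrix_none {n : ℕ} : layerMatrix (none : Option (Fin n)) = 1 := by
  ext x y
  simp [layerMatrix, LayerCompat, Matrix.one_apply, funext_iff]

theorem layerMatrix_mul_self (i : Fin 2) :
    layerMatrix (some i) * layerMatrix (some i) = (2 : ℤ) • layerMatrix (some i) := by
  revert i; decide +kernel

theorem layerMatrix_braid (i j : Fin 2) (h : i ≠ j) :
    layerMatrix (some i) * layerMatrix (some j) * layerMatrix (some i) =
      layerMatrix (some i) := by
  revert i j; decide +kernel

theorem trace_layerMatrix (i : Fin 2) : (layerMatrix (some i)).trace = 4 := by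
  revert i; decide +kernel

theorem trace_layerMatrix_mul (i j : Fin 2) (h : i ≠ j) :
    (layerMatrix (some i) * layerMatrix (some j)).trace = 2 := by
  revert i j; decide +kernel

end FlatStack

/-! ### Temperley-Lieb normal forms and the Markov trace on three strands. -/

/-- The relations of the Temperley-Lieb algebra on three strands with loop value `d`. -/
structure IsTemperleyLieb {K A : Type*} [CommRing K] [Ring A] [Algebra K A] (d : K)
    (E : Fin 2 → A) : Prop where
  mul_self : ∀ i, E i * E i = d • E i
  braid : ∀ i j, i ≠ j → E i * E j * E i = E i

namespace FlatStack

/-- The product of the images of the layers of a stack, the vertical layer being sent to `1`. -/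
def eval {n : ℕ} {A : Type*} [Monoid A] (E : Fin n → A) (L : FlatStack n) : A :=
  (L.map fun o => o.elim 1 E).prod

theorem eval_cons_none {n : ℕ} {A : Type*} [Monoid A] (E : Fin n → A) (L : FlatStack n) :
    eval E (none :: L) = eval E L := by simp [eval]

theorem eval_cons_some {n : ℕ} {A : Type*} [Monoid A] (E : Fin n → A) (i : Fin n)
    (L : FlatStack n) : eval E (some i :: L) = E i * eval E L := by simp [eval]

/-- Reduction of a stack on three strands to a power of the loop value times one of the words
`1`, `E i`, `E i * E j`. -/
theorem exists_eval_eq (L : FlatStack 2) :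
    (∀ o ∈ L, o = none) ∨ (∃ o ∈ L, o ≠ none) ∧ ∃ c : ℕ,
      (∃ i, ∀ (K A : Type) [CommRing K] [Ring A] [Algebra K A] (d : K) (E : Fin 2 → A),
        IsTemperleyLieb d E → eval E L = d ^ c • E i) ∨
      (∃ i j, i ≠ j ∧ ∀ (K A : Type) [CommRing K] [Ring A] [Algebra K A] (d : K) (E : Fin 2 → A),
        IsTemperleyLieb d E → eval E L = d ^ c • (E i * E j)) := by
  induction L with
  | nil => simp
  | cons o L ih =>
    cases o with
    | none => simpa [eval_cons_none] using ih
    | some i =>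
      right
      refine ⟨⟨some i, by simp, by simp⟩, ?_⟩
      rcases ih with h | ⟨-, c, ⟨j, h⟩ | ⟨j, k, hjk, h⟩⟩
      · refine ⟨0, .inl ⟨i, fun K A _ _ _ d E _ => ?_⟩⟩
        have : eval E L = 1 := List.prod_eq_one fun a ha => by
          obtain ⟨o, ho, rfl⟩ := List.mem_map.1 ha
          rw [h o ho]; rfl
        simp [eval_cons_some, this]
      · by_cases hij : i = j
        · subst hij
          refine ⟨c + 1, .inl ⟨i, fun K A _ _ _ d E hE => ?_⟩⟩
          rw [eval_cons_some, h K A d E hE, mul_smul_comm, hE.mul_self, smul_smul, pow_succ]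
        · refine ⟨c, .inr ⟨i, j, hij, fun K A _ _ _ d E hE => ?_⟩⟩
          rw [eval_cons_some, h K A d E hE, mul_smul_comm]
      · by_cases hij : i = j
        · subst hij
          refine ⟨c + 1, .inr ⟨i, k, hjk, fun K A _ _ _ d E hE => ?_⟩⟩
          rw [eval_cons_some, h K A d E hE, mul_smul_comm, ← mul_assoc, hE.mul_self,
            smul_mul_assoc, smul_smul, pow_succ]
        -- There are only two generators, so `i ≠ j` and `j ≠ k` force `i = k`.
        · obtain rfl : i = k := by omega
          refine ⟨c, .inl ⟨i, fun K A _ _ _ d E hE => ?_⟩⟩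
          rw [eval_cons_some, h K A d E hE, mul_smul_comm, ← mul_assoc, hE.braid _ _ hij]

theorem isTemperleyLieb_layerMatrix :
    IsTemperleyLieb (2 : ℤ) fun i : Fin 2 => layerMatrix (some i) :=
  ⟨layerMatrix_mul_self, layerMatrix_braid⟩

theorem two_pow_circles_eq_eval {n : ℕ} (L : FlatStack n) :
    (2 : ℤ) ^ L.circles = (eval (fun i => layerMatrix (some i)) L).trace := by
  rw [two_pow_circles, eval]
  congr 2
  refine List.map_congr_left fun o _ => ?_
  cases o
  · exact layerMatrix_none
  · rfl

/-- The Markov trace on three strands in terms of the one-dimensional representation that sends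
the generators to `0` and of a two-dimensional representation. -/
theorem pow_circles_sub_one {K : Type} [CommRing K] (d : K) (E : Fin 2 → Matrix (Fin 2) (Fin 2) K)
    (hE : IsTemperleyLieb d E) (h1 : ∀ i, (E i).trace = d)
    (h2 : ∀ i j, i ≠ j → (E i * E j).trace = 1) (L : FlatStack 2) :
    d ^ (L.circles - 1) = (d ^ 2 - 2) * eval (fun _ => 0) L + (eval E L).trace := by
  have h := two_pow_circles_eq_eval L
  have key : ∀ m : ℕ, (2 : ℤ) ^ L.circles = 2 ^ m → L.circles = m := fun m hm =>
    Nat.pow_right_injective le_rfl (by exact_mod_cast hm)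
  -- The relations have no constant term, so zero generators satisfy them for every `d`.
  have hz : IsTemperleyLieb d fun _ : Fin 2 => (0 : K) := ⟨by simp, by simp⟩
  -- One reduction, with one exponent `c`, serves all three representations. The colouring trace
  -- shows that the normal forms close up to 3, `c + 2` and `c + 1` circles.
  rcases exists_eval_eq L with hL | ⟨-, c, ⟨i, hi⟩ | ⟨i, j, hij, hi⟩⟩
  · have e : ∀ {A : Type} [Ring A] (E : Fin 2 → A), eval E L = 1 := fun E =>
      List.prod_eq_one fun a ha => by
        obtain ⟨o, ho, rfl⟩ := List.mem_map.1 ha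
        rw [hL o ho]; rfl
    rw [e, Matrix.trace_one] at h
    rw [key 3 (by rw [h]; simp), e, e, Matrix.trace_one]
    simp
  · rw [hi _ _ 2 _ isTemperleyLieb_layerMatrix, Matrix.trace_smul, trace_layerMatrix] at h
    rw [key (c + 2) (by rw [h, pow_add]; norm_num), hi _ _ d _ hE, hi _ _ d _ hz,
      Matrix.trace_smul, h1]
    simp [pow_succ]
  · rw [hi _ _ 2 _ isTemperleyLieb_layerMatrix, Matrix.trace_smul,
      trace_layerMatrix_mul _ _ hij] at h
    rw [key (c + 1) (by rw [h, pow_add]; norm_num), hi _ _ d _ hE, hi _ _ d _ hz,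
      Matrix.trace_smul, h2 _ _ hij]
    simp

end FlatStack

/-! ### The Kauffman bracket as a trace. -/

namespace BraidWord

open LaurentPolynomial

/-- The skein resolution of a letter. -/
noncomputable def letterImage {n : ℕ} {A : Type*} [Ring A] [Algebra ℤ[T;T⁻¹] A] (E : Fin n → A)
    (l : Fin n × Bool) : A :=
  if l.2 then (T (-1) : ℤ[T;T⁻¹]) • 1 + (T 1 : ℤ[T;T⁻¹]) • E l.1
  else (T 1 : ℤ[T;T⁻¹]) • 1 + (T (-1) : ℤ[T;T⁻¹]) • E l.1

/-- The image of a braid word under the skein resolution of its letters. -/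
noncomputable def image {n : ℕ} {A : Type*} [Ring A] [Algebra ℤ[T;T⁻¹] A] (E : Fin n → A)
    (w : BraidWord n) : A :=
  (w.map (letterImage E)).prod

theorem image_append {n : ℕ} {A : Type*} [Ring A] [Algebra ℤ[T;T⁻¹] A] (E : Fin n → A)
    (v w : BraidWord n) : image E (v ++ w) = image E v * image E w := by
  simp [image]

theorem resolve_cons {n : ℕ} (l : Fin n × Bool) (w : BraidWord n) (b : Bool)
    (S : Fin w.length → Bool) :
    resolve (l :: w) (Fin.cons b S : Fin (w.length + 1) → Bool) =
      (if b = l.2 then some l.1 else none) :: w.resolve S := by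
  simp [resolve]

/-- Choosing a resolution at every crossing amounts to choosing a summand in every factor when the
product of the letter images is expanded. -/
theorem sum_states {n : ℕ} {A : Type*} [Ring A] [Algebra ℤ[T;T⁻¹] A] (E : Fin n → A)
    (w : BraidWord n) :
    ∑ S : Fin w.length → Bool, (T (∑ j, if S j then (1 : ℤ) else -1) : ℤ[T;T⁻¹]) •
      FlatStack.eval E (w.resolve S) = w.image E := by
  induction w with
  | nil =>
    simp [image, resolve, FlatStack.eval]
  | cons l w ih =>
    have : image E (l :: w) = letterImage E l * image E w := by simp [image]
    rw [this, ← ih]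
    refine ((Fin.consEquiv (fun _ : Fin (w.length + 1) => Bool)).sum_comp _).symm.trans ?_
    rw [Fintype.sum_prod_type]
    have key : ∀ (b : Bool) (S : Fin w.length → Bool),
        (T (∑ j : Fin (w.length + 1),
          if (Fin.cons b S : Fin (w.length + 1) → Bool) j then (1 : ℤ) else -1) : ℤ[T;T⁻¹]) •
          FlatStack.eval E (resolve (l :: w) (Fin.cons b S : Fin (w.length + 1) → Bool)) =
        ((T (if b then 1 else -1) : ℤ[T;T⁻¹]) • (if b = l.2 then E l.1 else 1)) *
          ((T (∑ j, if S j then (1 : ℤ) else -1) : ℤ[T;T⁻¹]) •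
            FlatStack.eval E (resolve w S)) := by
      intro b S
      rw [resolve_cons, Fin.sum_univ_succ, T_add]
      simp only [Fin.cons_zero, Fin.cons_succ]
      split_ifs <;>
        simp only [FlatStack.eval_cons_none, FlatStack.eval_cons_some, mul_smul, smul_mul_assoc,
          mul_smul_comm, one_mul, smul_comm (T _ : ℤ[T;T⁻¹]) (T (∑ j, _) : ℤ[T;T⁻¹])]
    have key' := fun b => Finset.sum_congr (s₁ := Finset.univ) rfl fun S _ => key b S
    refine (Finset.sum_congr rfl fun b _ => key' b).trans ?_
    simp only [← Finset.mul_sum, ← Finset.sum_mul]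
    congr 1
    rcases l with ⟨i, _ | _⟩ <;> simp [letterImage, add_comm]

theorem kauffmanBracket_eq (E : Fin 2 → Matrix (Fin 2) (Fin 2) ℤ[T;T⁻¹])
    (hE : IsTemperleyLieb (-T 2 - T (-2) : ℤ[T;T⁻¹]) E)
    (h1 : ∀ i, (E i).trace = -T 2 - T (-2))
    (h2 : ∀ i j, i ≠ j → (E i * E j).trace = 1) (w : BraidWord 2) :
    w.kauffmanBracket = (T 4 + T (-4)) * T w.writhe + (w.image E).trace := by
  have hw : w.image (fun _ => (0 : ℤ[T;T⁻¹])) = T w.writhe := by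
    induction w with
    | nil => simp [image, writhe]
    | cons l w ih =>
      have e : image (fun _ => (0 : ℤ[T;T⁻¹])) (l :: w) =
        letterImage (fun _ => (0 : ℤ[T;T⁻¹])) l * image (fun _ => (0 : ℤ[T;T⁻¹])) w := by
        simp [image]
      have e' : writhe (l :: w) = (if l.2 then -1 else 1) + writhe w := by simp [writhe]
      rw [e, ih, e', T_add]
      congr 1
      rcases l with ⟨i, _ | _⟩ <;> simp [letterImage]
  have hd : ((-T 2 - T (-2)) ^ 2 - 2 : ℤ[T;T⁻¹]) = T 4 + T (-4) := by
    have e1 : (T 4 : ℤ[T;T⁻¹]) = T 2 * T 2 := by rw [← T_add]; rfl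
    have e2 : (T (-4) : ℤ[T;T⁻¹]) = T (-2) * T (-2) := by rw [← T_add]; rfl
    have e3 : (T 2 * T (-2) : ℤ[T;T⁻¹]) = 1 := by rw [← T_add]; rfl
    rw [e1, e2]; linear_combination 2 * e3
  rw [← hw, ← hd, ← sum_states, ← sum_states, Matrix.trace_sum, Finset.mul_sum,
    ← Finset.sum_add_distrib]
  refine Finset.sum_congr rfl fun S _ => ?_
  rw [FlatStack.pow_circles_sub_one _ E hE h1 h2, Matrix.trace_smul, smul_eq_mul, smul_eq_mul]
  ring

end BraidWord

/-! ### Reading extremal Jones coefficients off a polynomial in `-A⁴` or `-A⁻⁴`. -/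

namespace LaurentPolynomial

open Polynomial in
theorem T_mul_aeval_neg_T (m c : ℤ) (H : ℤ[X]) :
    T m * aeval (-T c : ℤ[T;T⁻¹]) H =
      ∑ n ∈ H.support, AddMonoidAlgebra.single (m + c * n) ((-1) ^ n * H.coeff n) := by
  rw [aeval_def, eval₂_eq_sum, Polynomial.sum,
    Finset.mul_sum]
  refine Finset.sum_congr rfl fun n _ => ?_
  rw [single_eq_C_mul_T, neg_pow, T_pow, T_add, mul_comm c, map_mul, map_pow, map_neg, map_one,
    ← C_eq_algebraMap]
  ring

open Polynomial in
theorem coeff_T_mul_aeval_neg_T (m : ℤ) {c : ℤ} (hc : c ≠ 0) (H : ℤ[X]) (n : ℕ) :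
    (T m * aeval (-T c : ℤ[T;T⁻¹]) H).coeff (m + c * n) = (-1) ^ n * H.coeff n := by
  rw [T_mul_aeval_neg_T, AddMonoidAlgebra.coeff_sum, Finsupp.finsetSum_apply,
    Finset.sum_eq_single n]
  · simp [AddMonoidAlgebra.coeff_single, -single_eq_C_mul_T]
  · intro k _ hk
    simp [AddMonoidAlgebra.coeff_single, -single_eq_C_mul_T, hc, hk]
  · intro hn
    simp [Polynomial.notMem_support_iff.1 hn]

open Polynomial in
theorem exists_of_coeff_T_mul_aeval_neg_T_ne_zero (m c : ℤ) (H : ℤ[X]) (k : ℤ)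
    (hk : (T m * aeval (-T c : ℤ[T;T⁻¹]) H).coeff k ≠ 0) :
    ∃ n : ℕ, k = m + c * n ∧ H.coeff n ≠ 0 := by
  rw [T_mul_aeval_neg_T, AddMonoidAlgebra.coeff_sum, Finsupp.finsetSum_apply] at hk
  obtain ⟨n, hn, h⟩ := Finset.exists_ne_zero_of_sum_ne_zero hk
  rw [AddMonoidAlgebra.coeff_single, Finsupp.single_apply] at h
  refine ⟨n, ?_, Polynomial.mem_support_iff.1 hn⟩
  by_contra hne
  exact h (if_neg (Ne.symm hne))

end LaurentPolynomial

namespace BraidWord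

open LaurentPolynomial Polynomial

theorem coeff_jones {n : ℕ} (w : BraidWord n) (m : ℤ) :
    w.jones.coeff (-(m : ℚ) / 4) = w.normalizedBracket.coeff m := by
  have hinj : Function.Injective fun m : ℤ => -(m : ℚ) / 4 := fun a b h => by
    simpa [div_left_inj'] using h
  exact Finsupp.mapDomain_apply hinj _ m

theorem exists_of_coeff_jones_ne_zero {n : ℕ} (w : BraidWord n) (r : ℚ)
    (h : w.jones.coeff r ≠ 0) :
    ∃ m : ℤ, r = -(m : ℚ) / 4 ∧ w.normalizedBracket.coeff m ≠ 0 := by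
  by_cases hr : r ∈ Set.range fun m : ℤ => -(m : ℚ) / 4
  · obtain ⟨m, rfl⟩ := hr
    exact ⟨m, rfl, by rwa [← coeff_jones]⟩
  · exact absurd (Finsupp.mapDomain_of_notMem_range _ _ hr) h

/-- Since `A⁴ = t⁻¹`, low powers in `H` are high powers of `t`. The constant term vanishes, so the
top power sits at index 1 and the second coefficient at index 2, where the sign is `+1`. -/
theorem isSecondCoeff_of_normalizedBracket_eq {n : ℕ} (w : BraidWord n) (m : ℤ) (H : ℤ[X])
    (hw : w.normalizedBracket = T m * aeval (-T 4 : ℤ[T;T⁻¹]) H) (h0 : H.coeff 0 = 0)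
    (h1 : H.coeff 1 ≠ 0) : IsSecondCoeff w.jones (H.coeff 2) := by
  refine ⟨-((m + 4 * (1 : ℕ) : ℤ) : ℚ) / 4, ⟨?_, ?_⟩, ?_⟩
  · rw [Set.mem_ofPred_eq, coeff_jones, hw, coeff_T_mul_aeval_neg_T m (by norm_num)]
    simpa using h1
  · intro r hr
    obtain ⟨k, rfl, hk⟩ := exists_of_coeff_jones_ne_zero w r hr
    rw [hw] at hk
    obtain ⟨j, rfl, hj⟩ := exists_of_coeff_T_mul_aeval_neg_T_ne_zero _ _ _ _ hk
    have : 1 ≤ j := Nat.one_le_iff_ne_zero.2 fun h => hj (h ▸ h0)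
    have : (1 : ℚ) ≤ j := by exact_mod_cast this
    push_cast
    linarith
  · have : -((m + 4 * (1 : ℕ) : ℤ) : ℚ) / 4 - 1 = -((m + 4 * (2 : ℕ) : ℤ) : ℚ) / 4 := by
      push_cast; ring
    rw [this, coeff_jones, hw, coeff_T_mul_aeval_neg_T m (by norm_num)]
    simp

/-- Here `-A⁻⁴ = -t`, so the order of powers is kept and index 1 carries a sign. -/
theorem isNextToLastCoeff_of_normalizedBracket_eq {n : ℕ} (w : BraidWord n) (m : ℤ) (H : ℤ[X])
    (hw : w.normalizedBracket = T m * aeval (-T (-4) : ℤ[T;T⁻¹]) H) (h0 : H.coeff 0 ≠ 0) :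
    IsNextToLastCoeff w.jones (-H.coeff 1) := by
  refine ⟨-((m + -4 * (0 : ℕ) : ℤ) : ℚ) / 4, ⟨?_, ?_⟩, ?_⟩
  · rw [Set.mem_ofPred_eq, coeff_jones, hw, coeff_T_mul_aeval_neg_T m (by norm_num)]
    simpa using h0
  · intro r hr
    obtain ⟨k, rfl, hk⟩ := exists_of_coeff_jones_ne_zero w r hr
    rw [hw] at hk
    obtain ⟨j, rfl, hj⟩ := exists_of_coeff_T_mul_aeval_neg_T_ne_zero _ _ _ _ hk
    have : (0 : ℚ) ≤ j := by positivity
    push_cast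
    linarith
  · have : -((m + -4 * (0 : ℕ) : ℤ) : ℚ) / 4 + 1 = -((m + -4 * (1 : ℕ) : ℤ) : ℚ) / 4 := by
      push_cast; ring
    rw [this, coeff_jones, hw, coeff_T_mul_aeval_neg_T m (by norm_num)]
    simp

end BraidWord

/-! ### Burau blocks truncated at both ends. -/

namespace TwistBlock

open Polynomial

/-- `v ^ q X ^ p Y ^ q` for the reduced Burau matrices `X = !![v, 1; 0, 1]` and
`Y = !![1, 0; 1, v⁻¹]`, as a matrix of polynomials in `v`. -/
noncomputable def low (p q : ℕ) : Matrix (Fin 2) (Fin 2) ℤ[X] :=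
  !![X, 1; 0, 1] ^ p * !![X, 0; X, 1] ^ q

/-- `v ^ (-p) X ^ p Y ^ q` for the reduced Burau matrices `X = !![v, 1; 0, 1]` and
`Y = !![1, 0; 1, v⁻¹]`, as a matrix of polynomials in `v⁻¹`. -/
noncomputable def high (p q : ℕ) : Matrix (Fin 2) (Fin 2) ℤ[X] :=
  !![1, X; 0, X] ^ p * !![1, 0; 1, X] ^ q

theorem pow_eq_of_stable {M : Type*} [Monoid M] {a b : M} {k : ℕ} (h : a ^ k = b)
    (hb : a * b = b) {n : ℕ} (hn : k ≤ n) : a ^ n = b := by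
  induction n, hn using Nat.le_induction with
  | base => exact h
  | succ n _ ih => rw [pow_succ', ih, hb]

/-- Modulo `x ^ 3` the powers of each factor are constant from the third on, so the exponents drop
out. -/
theorem low_eq_of_cube_eq_zero {R : Type*} [CommRing R] {x : R} (hx : x ^ 3 = 0) {p q : ℕ}
    (hp : 3 ≤ p) (hq : 3 ≤ q) :
    !![x, 1; 0, 1] ^ p * !![x, 0; x, 1] ^ q =
      !![x + 2 * x ^ 2, 1 + x + x ^ 2; x + x ^ 2, 1] := by
  have h1 : !![x, 1; 0, 1] ^ p = !![0, 1 + x + x ^ 2; 0, 1] := by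
    refine pow_eq_of_stable (k := 3) ?_ ?_ hp
    · ext i j; fin_cases i <;> fin_cases j <;> simp [pow_succ] <;>
        first | ring1 | linear_combination hx
    · ext i j; fin_cases i <;> fin_cases j <;> simp <;>
        first | ring1 | linear_combination hx
  have h2 : !![x, 0; x, 1] ^ q = !![0, 0; x + x ^ 2, 1] := by
    refine pow_eq_of_stable (k := 3) ?_ ?_ hq
    · ext i j; fin_cases i <;> fin_cases j <;> simp [pow_succ] <;>
        first | ring1 | linear_combination hx
    · ext i j; fin_cases i <;> fin_cases j <;> simp
  rw [h1, h2]
  ext i j; fin_cases i <;> fin_cases j <;> simp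
  linear_combination (x + 2) * hx

theorem high_eq_of_sq_eq_zero {R : Type*} [CommRing R] {x : R} (hx : x ^ 2 = 0) {p q : ℕ}
    (hp : 2 ≤ p) (hq : 2 ≤ q) :
    !![1, x; 0, x] ^ p * !![1, 0; 1, x] ^ q = !![1 + x, 0; 0, 0] := by
  have h1 : !![1, x; 0, x] ^ p = !![1, x; 0, 0] := by
    refine pow_eq_of_stable (k := 2) ?_ ?_ hp
    · ext i j; fin_cases i <;> fin_cases j <;> simp [pow_succ] <;>
        first | ring1 | linear_combination hx
    · ext i j; fin_cases i <;> fin_cases j <;> simp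
  have h2 : !![1, 0; 1, x] ^ q = !![1, 0; 1 + x, 0] := by
    refine pow_eq_of_stable (k := 2) ?_ ?_ hq
    · ext i j; fin_cases i <;> fin_cases j <;> simp [pow_succ] <;>
        first | ring1 | linear_combination hx
    · ext i j; fin_cases i <;> fin_cases j <;> simp <;>
        first | ring1 | linear_combination hx
  rw [h1, h2]
  ext i j; fin_cases i <;> fin_cases j <;> simp
  linear_combination hx

/-- The determinant is zero modulo `x ^ 3`, so by Cayley-Hamilton the square of the matrix is its
trace times itself. -/
theorem trace_low_pow {R : Type*} [CommRing R] {x : R} (hx : x ^ 3 = 0) (s : ℕ) :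
    (!![x + 2 * x ^ 2, 1 + x + x ^ 2; x + x ^ 2, 1] ^ (s + 1)).trace =
      (1 + x + 2 * x ^ 2) ^ (s + 1) := by
  have h : !![x + 2 * x ^ 2, 1 + x + x ^ 2; x + x ^ 2, 1] ^ (s + 1) =
      (1 + x + 2 * x ^ 2) ^ s • !![x + 2 * x ^ 2, 1 + x + x ^ 2; x + x ^ 2, 1] := by
    induction s with
    | zero => simp
    | succ s ih =>
      rw [pow_succ, ih, pow_succ _ s, mul_smul, Matrix.smul_mul]
      congr 1
      ext i j; fin_cases i <;> fin_cases j <;> simp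
      · linear_combination (2 + x) * hx
      · ring
      · ring
      · linear_combination (2 + x) * hx
  rw [h, Matrix.trace_smul, Matrix.trace_fin_two, pow_succ]
  simp; ring

theorem trace_high_pow {R : Type*} [CommRing R] (x : R) (s : ℕ) :
    (!![1 + x, 0; 0, 0] ^ (s + 1)).trace = (1 + x) ^ (s + 1) := by
  have h : !![1 + x, 0; 0, 0] ^ (s + 1) = !![(1 + x) ^ (s + 1), 0; 0, 0] := by
    induction s with
    | zero => simp
    | succ s ih =>
      rw [pow_succ, ih, pow_succ _ (s + 1)]
      ext i j; fin_cases i <;> fin_cases j <;> simp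
  rw [h, Matrix.trace_fin_two]
  simp

theorem mk_X_pow_eq_zero (k : ℕ) :
    Ideal.Quotient.mk (Ideal.span {(X : ℤ[X]) ^ k}) X ^ k = 0 := by
  rw [← map_pow, Ideal.Quotient.eq_zero_iff_mem]
  exact Ideal.mem_span_singleton_self _

theorem coeff_eq_of_mk_eq {k : ℕ} {f g : ℤ[X]}
    (h : Ideal.Quotient.mk (Ideal.span {(X : ℤ[X]) ^ k}) f = Ideal.Quotient.mk _ g) {n : ℕ}
    (hn : n < k) : f.coeff n = g.coeff n := by
  rw [Ideal.Quotient.eq, Ideal.mem_span_singleton, X_pow_dvd_iff] at h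
  simpa [sub_eq_zero] using h n hn

theorem trace_mapMatrix {R S : Type*} [CommRing R] [CommRing S] (f : R →+* S)
    (M : Matrix (Fin 2) (Fin 2) R) : (f.mapMatrix M).trace = f M.trace := by
  simp [Matrix.trace_fin_two]

theorem coeff_trace_low {s : ℕ} (p q : Fin (s + 1) → ℕ) (hp : ∀ i, 3 ≤ p i) (hq : ∀ i, 3 ≤ q i)
    {n : ℕ} (hn : n < 3) :
    (List.ofFn fun i => low (p i) (q i)).prod.trace.coeff n =
      ((1 + X + 2 * X ^ 2 : ℤ[X]) ^ (s + 1)).coeff n := by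
  refine coeff_eq_of_mk_eq ?_ hn
  set f := Ideal.Quotient.mk (Ideal.span {(X : ℤ[X]) ^ 3})
  have hx : f X ^ 3 = 0 := mk_X_pow_eq_zero 3
  have hb : ∀ i, f.mapMatrix (low (p i) (q i)) =
      !![f X + 2 * f X ^ 2, 1 + f X + f X ^ 2; f X + f X ^ 2, 1] := fun i => by
    rw [← low_eq_of_cube_eq_zero hx (hp i) (hq i), low, map_mul, map_pow, map_pow]
    congr 2 <;> ext i j <;> fin_cases i <;> fin_cases j <;> simp
  rw [← trace_mapMatrix, map_list_prod, List.map_ofFn]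
  simp only [Function.comp_def, hb, List.ofFn_const, List.prod_replicate]
  rw [trace_low_pow hx, map_pow, map_add, map_add, map_one, map_mul, map_pow, map_ofNat]

theorem coeff_trace_high {s : ℕ} (p q : Fin (s + 1) → ℕ) (hp : ∀ i, 2 ≤ p i)
    (hq : ∀ i, 2 ≤ q i) {n : ℕ} (hn : n < 2) :
    (List.ofFn fun i => high (p i) (q i)).prod.trace.coeff n =
      ((1 + X : ℤ[X]) ^ (s + 1)).coeff n := by
  refine coeff_eq_of_mk_eq ?_ hn
  set f := Ideal.Quotient.mk (Ideal.span {(X : ℤ[X]) ^ 2})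
  have hx : f X ^ 2 = 0 := mk_X_pow_eq_zero 2
  have hb : ∀ i, f.mapMatrix (high (p i) (q i)) = !![1 + f X, 0; 0, 0] := fun i => by
    rw [← high_eq_of_sq_eq_zero hx (hp i) (hq i), high, map_mul, map_pow, map_pow]
    congr 2 <;> ext i j <;> fin_cases i <;> fin_cases j <;> simp
  rw [← trace_mapMatrix, map_list_prod, List.map_ofFn]
  simp only [Function.comp_def, hb, List.ofFn_const, List.prod_replicate]
  rw [trace_high_pow]
  simp

theorem coeff_quadratic_pow (s : ℕ) :
    ((1 + X + 2 * X ^ 2 : ℤ[X]) ^ s).coeff 0 = 1 ∧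
      ((1 + X + 2 * X ^ 2 : ℤ[X]) ^ s).coeff 1 = s ∧
      2 * ((1 + X + 2 * X ^ 2 : ℤ[X]) ^ s).coeff 2 = s * (s + 3) := by
  have e0 : (1 + X + 2 * X ^ 2 : ℤ[X]).coeff 0 = 1 := by simp
  have e1 : (1 + X + 2 * X ^ 2 : ℤ[X]).coeff 1 = 1 := by
    simp [coeff_one, coeff_X, coeff_ofNat_mul, coeff_X_pow]
  have e2 : (1 + X + 2 * X ^ 2 : ℤ[X]).coeff 2 = 2 := by
    simp [coeff_one, coeff_X, coeff_ofNat_mul, coeff_X_pow]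
  induction s with
  | zero => simp [coeff_one]
  | succ s ih =>
    obtain ⟨h0, h1, h2⟩ := ih
    rw [pow_succ]
    refine ⟨by rw [mul_coeff_zero, h0, e0, mul_one], ?_, ?_⟩
    · rw [mul_coeff_one, h0, h1, e0, e1]; push_cast; ring
    · rw [coeff_mul, Finset.Nat.sum_antidiagonal_eq_sum_range_succ_mk, Finset.sum_range_succ,
        Finset.sum_range_succ, Finset.sum_range_one]
      simp only [h0, h1, e0, e1, e2, Nat.sub_zero, Nat.sub_self, Nat.add_one_sub_one]
      push_cast
      linear_combination h2

end TwistBlock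

/-! ### The Burau representation on letters, full twists and blocks. -/

namespace BraidWord

open LaurentPolynomial Polynomial

/-- A two-dimensional representation of the Temperley-Lieb algebra on three strands. -/
noncomputable def skeinRep : Fin 2 → Matrix (Fin 2) (Fin 2) ℤ[T;T⁻¹] :=
  ![!![-T 2 - T (-2), T (-2); 0, 0], !![0, 0; T 2, -T 2 - T (-2)]]

theorem T_two_mul_T_neg_two : (T 2 * T (-2) : ℤ[T;T⁻¹]) = 1 := by rw [← T_add]; rfl

theorem isTemperleyLieb_skeinRep : IsTemperleyLieb (-T 2 - T (-2) : ℤ[T;T⁻¹]) skeinRep := by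
  have h := T_two_mul_T_neg_two
  unfold skeinRep
  generalize (T 2 : ℤ[T;T⁻¹]) = a at *
  generalize (T (-2) : ℤ[T;T⁻¹]) = b at *
  constructor
  · intro i
    fin_cases i <;> ext i j : 1 <;> fin_cases i <;> fin_cases j <;> simp
  · intro i j hij
    fin_cases i <;> fin_cases j <;> first | exact absurd rfl hij | skip
    all_goals
      ext i j : 1
      fin_cases i <;> fin_cases j <;> simp
    · linear_combination (-a - b) * h
    · linear_combination b * h
    · linear_combination a * h
    · linear_combination (-a - b) * h

theorem trace_skeinRep (i : Fin 2) : (skeinRep i).trace = -T 2 - T (-2) := by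
  fin_cases i <;> simp [skeinRep, Matrix.trace_fin_two]

theorem trace_skeinRep_mul (i j : Fin 2) (hij : i ≠ j) : (skeinRep i * skeinRep j).trace = 1 := by
  have h := T_two_mul_T_neg_two
  unfold skeinRep
  generalize (T 2 : ℤ[T;T⁻¹]) = a at *
  generalize (T (-2) : ℤ[T;T⁻¹]) = b at *
  fin_cases i <;> fin_cases j <;> first | exact absurd rfl hij | skip
  · simpa [Matrix.trace_fin_two] using (mul_comm _ _).trans h
  · simpa [Matrix.trace_fin_two] using h

theorem T_one_mul_T_two : (T 1 * T 2 : ℤ[T;T⁻¹]) = T (-1) * T 4 := by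
  rw [← T_add, ← T_add]; rfl

theorem T_one_mul_T_neg_two : (T 1 * T (-2) : ℤ[T;T⁻¹]) = T (-1) := by rw [← T_add]; rfl

/-- The off-diagonal entries of `skeinRep` need product 1; the split into `T (-2)` and `T 2` leaves,
up to a scalar, only powers of `T 4` in the letter images. -/
theorem letterImage_zero_true :
    letterImage skeinRep (0, true) = (T (-1) : ℤ[T;T⁻¹]) • !![-T 4, 1; 0, 1] := by
  have h1 := T_one_mul_T_two
  have h2 := T_one_mul_T_neg_two
  simp only [letterImage, skeinRep, if_true]
  generalize (T 2 : ℤ[T;T⁻¹]) = a at *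
  generalize (T (-2) : ℤ[T;T⁻¹]) = b at *
  generalize (T 1 : ℤ[T;T⁻¹]) = c at *
  generalize (T (-1) : ℤ[T;T⁻¹]) = c' at *
  generalize (T 4 : ℤ[T;T⁻¹]) = e at *
  ext i j : 1
  fin_cases i <;> fin_cases j <;> simp
  · linear_combination -h1 - h2
  · exact h2

theorem letterImage_one_true :
    letterImage skeinRep (1, true) = (T (-1) : ℤ[T;T⁻¹]) • !![1, 0; T 4, -T 4] := by
  have h1 := T_one_mul_T_two
  have h2 := T_one_mul_T_neg_two
  simp only [letterImage, skeinRep, if_true]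
  generalize (T 2 : ℤ[T;T⁻¹]) = a at *
  generalize (T (-2) : ℤ[T;T⁻¹]) = b at *
  generalize (T 1 : ℤ[T;T⁻¹]) = c at *
  generalize (T (-1) : ℤ[T;T⁻¹]) = c' at *
  generalize (T 4 : ℤ[T;T⁻¹]) = e at *
  ext i j : 1
  fin_cases i <;> fin_cases j <;> simp
  · exact h1
  · linear_combination -h1 - h2

theorem letterImage_one_false :
    letterImage skeinRep (1, false) = (T 1 : ℤ[T;T⁻¹]) • !![1, 0; 1, -T (-4)] := by
  have h1 : (T (-1) * T 2 : ℤ[T;T⁻¹]) = T 1 := by rw [← T_add]; rfl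
  have h2 : (T (-1) * T (-2) : ℤ[T;T⁻¹]) = T 1 * T (-4) := by rw [← T_add, ← T_add]; rfl
  simp only [letterImage, skeinRep, Bool.false_eq_true, if_false]
  generalize (T 2 : ℤ[T;T⁻¹]) = a at *
  generalize (T (-2) : ℤ[T;T⁻¹]) = b at *
  generalize (T 1 : ℤ[T;T⁻¹]) = c at *
  generalize (T (-1) : ℤ[T;T⁻¹]) = c' at *
  generalize (T (-4) : ℤ[T;T⁻¹]) = e at *
  ext i j : 1
  fin_cases i <;> fin_cases j <;> simp
  · exact h1
  · linear_combination -h1 - h2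

/-- The Burau product is `-v ^ 3`, which is `T 12` at `v = -T 4`; the six letter scalars `T (-1)`
leave `T 6`. -/
theorem image_fullTwist : image skeinRep fullTwist = (T 6 : ℤ[T;T⁻¹]) • 1 := by
  have h : ∀ v : ℤ[T;T⁻¹], !![v, 1; 0, 1] * (!![1, 0; -v, v] * (!![v, 1; 0, 1] *
      (!![v, 1; 0, 1] * (!![1, 0; -v, v] * !![v, 1; 0, 1])))) = (-v ^ 3) • 1 := by
    intro v
    ext i j : 1
    fin_cases i <;> fin_cases j <;> simp <;> ring1
  have h4 := h (-T 4)
  rw [neg_neg] at h4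
  simp only [image, fullTwist, List.map_cons, List.map_nil, List.prod_cons, List.prod_nil,
    letterImage_zero_true, letterImage_one_true, mul_one, Matrix.smul_mul, Matrix.mul_smul,
    smul_smul, h4]
  congr 1
  rw [Odd.neg_pow (by decide), neg_neg, T_pow]
  simp only [← T_add]
  rfl

theorem image_flatten {n : ℕ} {A : Type*} [Ring A] [Algebra ℤ[T;T⁻¹] A] (E : Fin n → A)
    (l : List (BraidWord n)) : image E (l.flatten : List _) = (l.map (image E)).prod := by
  induction l with
  | nil => simp [image]
  | cons w l ih => rw [List.flatten_cons, image_append, ih, List.map_cons, List.prod_cons]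

theorem perm_append {n : ℕ} (v w : BraidWord n) : perm (v ++ w) = perm v * perm w := by
  simp [perm]

theorem perm_flatten {n : ℕ} (l : List (BraidWord n)) :
    perm (l.flatten : List _) = (l.map perm).prod := by
  induction l with
  | nil => simp [perm]
  | cons w l ih => rw [List.flatten_cons, perm_append, ih, List.map_cons, List.prod_cons]

theorem writhe_append {n : ℕ} (v w : BraidWord n) : writhe (v ++ w) = writhe v + writhe w := by
  simp [writhe]

theorem writhe_flatten {n : ℕ} (l : List (BraidWord n)) :
    writhe (l.flatten : List _) = (l.map writhe).sum := by
  induction l with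
  | nil => simp [writhe]
  | cons w l ih => rw [List.flatten_cons, writhe_append, ih, List.map_cons, List.sum_cons]

/-- The word `σ₁ ^ p σ₂ ^ (-p)`. -/
def twistBlock (p : ℕ) : BraidWord 2 :=
  List.replicate p (0, true) ++ List.replicate p (1, false)

theorem writhe_twistBlock (p : ℕ) : (twistBlock p).writhe = 0 := by
  simp [twistBlock, writhe]

theorem genericWord_self {s : ℕ} (k : ℕ) (p : Fin s → ℕ) :
    genericWord k p p = List.flatten (List.replicate k fullTwist) ++
      List.flatten (List.ofFn fun i => twistBlock (p i)) := rfl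

theorem image_twistBlock (p : ℕ) : image skeinRep (twistBlock p) =
    !![-T 4, 1; 0, 1] ^ p * !![1, 0; 1, -T (-4)] ^ p := by
  rw [twistBlock, image_append, image, image, List.map_replicate, List.map_replicate,
    List.prod_replicate, List.prod_replicate, letterImage_zero_true, letterImage_one_false,
    _root_.smul_pow, _root_.smul_pow, smul_mul_smul_comm, ← mul_pow, ← T_add]
  simp

/-- The factor `v ^ (-p)` clears the negative powers of `v` coming from `σ₂⁻¹`. -/
theorem image_twistBlock_eq_low (p : ℕ) : image skeinRep (twistBlock p) =
    (-T (-4) : ℤ[T;T⁻¹]) ^ p • (aeval (R := ℤ) (-T 4 : ℤ[T;T⁻¹])).toRingHom.mapMatrix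
      (TwistBlock.low p p) := by
  have h : (T (-4) * T 4 : ℤ[T;T⁻¹]) = 1 := by rw [← T_add]; rfl
  have h1 : (aeval (R := ℤ) (-T 4 : ℤ[T;T⁻¹])).toRingHom.mapMatrix !![X, 1; 0, 1] =
      !![-T 4, 1; 0, 1] := by
    ext i j : 1; fin_cases i <;> fin_cases j <;> simp
  have h2 : (-T (-4) : ℤ[T;T⁻¹]) • (aeval (R := ℤ) (-T 4 : ℤ[T;T⁻¹])).toRingHom.mapMatrix
      !![X, 0; X, 1] = !![1, 0; 1, -T (-4)] := by
    ext i j : 1; fin_cases i <;> fin_cases j <;> simp [h, -mul_T_assoc]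
  rw [TwistBlock.low, map_mul, map_pow, map_pow, ← Matrix.mul_smul, ← _root_.smul_pow, h1, h2,
    image_twistBlock]

theorem image_twistBlock_eq_high (p : ℕ) : image skeinRep (twistBlock p) =
    (-T 4 : ℤ[T;T⁻¹]) ^ p • (aeval (R := ℤ) (-T (-4) : ℤ[T;T⁻¹])).toRingHom.mapMatrix
      (TwistBlock.high p p) := by
  have h : (T 4 * T (-4) : ℤ[T;T⁻¹]) = 1 := by rw [← T_add]; rfl
  have h1 : (-T 4 : ℤ[T;T⁻¹]) • (aeval (R := ℤ) (-T (-4) : ℤ[T;T⁻¹])).toRingHom.mapMatrix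
      !![1, X; 0, X] = !![-T 4, 1; 0, 1] := by
    ext i j : 1; fin_cases i <;> fin_cases j <;> simp [h, -mul_T_assoc]
  have h2 : (aeval (R := ℤ) (-T (-4) : ℤ[T;T⁻¹])).toRingHom.mapMatrix !![1, 0; 1, X] =
      !![1, 0; 1, -T (-4)] := by
    ext i j : 1; fin_cases i <;> fin_cases j <;> simp
  rw [TwistBlock.high, map_mul, map_pow, map_pow, ← Matrix.smul_mul, ← _root_.smul_pow, h1, h2,
    image_twistBlock]

end BraidWord

theorem List.prod_map_smul_eq {ι K A : Type*} [CommSemiring K] [Semiring A] [Algebra K A]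
    (c : ι → K) (M : ι → A) (l : List ι) :
    (l.map fun i => c i • M i).prod = (l.map c).prod • (l.map M).prod := by
  induction l with
  | nil => simp
  | cons i l ih => simp [ih, smul_smul, mul_comm]

/-! ### The chosen knots and their normalized brackets. -/

namespace BraidWord

open LaurentPolynomial Polynomial

theorem trace_prod_smul_mapMatrix {s : ℕ} (a : ℤ[T;T⁻¹]) (f : ℤ[X] →+* ℤ[T;T⁻¹])
    (p : Fin s → ℕ) (M : Fin s → Matrix (Fin 2) (Fin 2) ℤ[X]) :
    (List.ofFn fun i => a ^ p i • f.mapMatrix (M i)).prod.trace =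
      a ^ (∑ i, p i) * f (List.ofFn M).prod.trace := by
  rw [List.ofFn_eq_map, List.prod_map_smul_eq, ← List.ofFn_eq_map, List.prod_ofFn,
    Finset.prod_pow_eq_pow_sum, Matrix.trace_smul, smul_eq_mul, ← TwistBlock.trace_mapMatrix,
    map_list_prod, List.ofFn_eq_map (f := M), List.map_map]
  rfl

/-- The exponents `7, 6, …, 6`. -/
def exponents (s : ℕ) (i : Fin (s + 1)) : ℕ := if i = 0 then 7 else 6

theorem le_exponents (s : ℕ) (i : Fin (s + 1)) : 6 ≤ exponents s i := by
  unfold exponents; split_ifs <;> norm_num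

/-- With `k = 2 * (s + 1)` this total is `3 * k + 1` and odd, as the cancellation of the lowest
terms requires. -/
theorem sum_exponents (s : ℕ) : ∑ i, exponents s i = 6 * (s + 1) + 1 := by
  rw [Fin.sum_univ_succ]
  simp [exponents, Fin.succ_ne_zero]
  ring

/-- The word `C ^ (2 (s + 1)) σ₁ ^ 7 σ₂ ^ (-7) (σ₁ ^ 6 σ₂ ^ (-6)) ^ s`. -/
def knotWord (s : ℕ) : BraidWord 2 :=
  genericWord ((2 * (s + 1) : ℕ) : ℤ) (exponents s) (exponents s)

theorem closureIsKnot_knotWord (s : ℕ) : (knotWord s).ClosureIsKnot := by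
  -- Only the block with exponent 7 permutes the strands, and it gives a 3-cycle.
  have h : (knotWord s).perm = Equiv.swap 0 1 * Equiv.swap 1 2 := by
    have hC : perm fullTwist = 1 := by decide
    have h6 : (twistBlock 6).perm = 1 := by decide
    have h7 : (twistBlock 7).perm = Equiv.swap 0 1 * Equiv.swap 1 2 := by decide
    rw [knotWord, genericWord_self, perm_append, perm_flatten, perm_flatten, List.map_replicate,
      hC, List.prod_replicate, one_pow, one_mul, List.map_ofFn, List.ofFn_succ, List.prod_cons]
    simp [exponents, Fin.succ_ne_zero, h6, h7, List.ofFn_const]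
  unfold ClosureIsKnot
  rw [h]
  decide

theorem writhe_knotWord (s : ℕ) : (knotWord s).writhe = -12 * (s + 1) := by
  have hC : writhe fullTwist = -6 := by decide
  rw [knotWord, genericWord_self, writhe_append, writhe_flatten, writhe_flatten,
    List.map_replicate, List.map_ofFn]
  simp [hC, Function.comp_def, writhe_twistBlock, List.ofFn_const]
  ring

theorem normalizedBracket_knotWord (s : ℕ) :
    (knotWord s).normalizedBracket = T (36 * (s + 1)) * ((T 4 + T (-4)) * T (-12 * (s + 1)) +
      T (12 * (s + 1)) *
        (List.ofFn fun i => image skeinRep (twistBlock (exponents s i))).prod.trace) := by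
  have hw := writhe_knotWord s
  have hs : (-3 * (knotWord s).writhe).negOnePow = 1 := by
    rw [hw]; exact Int.negOnePow_even _ ⟨18 * (s + 1), by ring⟩
  have hi : image skeinRep (knotWord s) = (T (12 * (s + 1)) : ℤ[T;T⁻¹]) •
      (List.ofFn fun i => image skeinRep (twistBlock (exponents s i))).prod := by
    rw [knotWord, genericWord_self, image_append, image_flatten, image_flatten,
      List.map_replicate, List.prod_replicate, image_fullTwist, _root_.smul_pow, one_pow, T_pow,
      Matrix.smul_mul, one_mul, List.map_ofFn]
    congr 2
    push_cast; ring
  rw [normalizedBracket, hs, kauffmanBracket_eq skeinRep isTemperleyLieb_skeinRep trace_skeinRep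
    trace_skeinRep_mul, hw, hi, Matrix.trace_smul, smul_eq_mul]
  rw [show (-3 * (-12 * ((s : ℤ) + 1))) = 36 * (s + 1) by ring]
  simp

theorem neg_T_pow_odd (m : ℤ) (s : ℕ) :
    (-T m : ℤ[T;T⁻¹]) ^ (6 * (s + 1) + 1) = -T ((6 * (s + 1) + 1) * m) := by
  rw [Odd.neg_pow ⟨3 * (s + 1), by ring⟩, T_pow]
  push_cast
  rfl

/-- By `e2` and `e3` the abelian term and the trace start at the same power of `A`; the odd total
makes their signs opposite. -/
theorem normalizedBracket_knotWord_eq_low (s : ℕ) :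
    (knotWord s).normalizedBracket = T (24 * (s + 1) - 4) * aeval (-T 4 : ℤ[T;T⁻¹])
      (1 + X ^ 2 - (List.ofFn fun i =>
        TwistBlock.low (exponents s i) (exponents s i)).prod.trace) := by
  rw [normalizedBracket_knotWord]
  simp only [image_twistBlock_eq_low]
  rw [trace_prod_smul_mapMatrix, sum_exponents, neg_T_pow_odd, map_sub, map_add, map_one,
    map_pow, aeval_X]
  set F := (List.ofFn fun i => TwistBlock.low (exponents s i) (exponents s i)).prod.trace
  change _ * (_ + _ * (_ * aeval (-T 4 : ℤ[T;T⁻¹]) F)) = _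
  have e1 : (T (36 * (s + 1)) * T 4 * T (-12 * (s + 1)) : ℤ[T;T⁻¹]) =
      T (24 * (s + 1) - 4) * (T 4 * T 4) := by
    simp only [← T_add]; congr 1; ring
  have e2 : (T (36 * (s + 1)) * T (-4) * T (-12 * (s + 1)) : ℤ[T;T⁻¹]) =
      T (24 * (s + 1) - 4) := by
    simp only [← T_add]; congr 1; ring
  have e3 : (T (36 * (s + 1)) * T (12 * (s + 1)) * T ((6 * (s + 1) + 1) * -4) : ℤ[T;T⁻¹]) =
      T (24 * (s + 1) - 4) := by
    simp only [← T_add]; congr 1; ring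
  linear_combination e1 + e2 - aeval (-T 4 : ℤ[T;T⁻¹]) F * e3

/-- From this end the abelian term enters only at degree `12 * (s + 1)`, too late to affect the last
two coefficients. -/
theorem normalizedBracket_knotWord_eq_high (s : ℕ) :
    (knotWord s).normalizedBracket = T (72 * (s + 1) + 4) * aeval (-T (-4) : ℤ[T;T⁻¹])
      (X ^ (12 * (s + 1)) + X ^ (12 * (s + 1) + 2) - (List.ofFn fun i =>
        TwistBlock.high (exponents s i) (exponents s i)).prod.trace) := by
  rw [normalizedBracket_knotWord]
  simp only [image_twistBlock_eq_high]
  rw [trace_prod_smul_mapMatrix, sum_exponents, neg_T_pow_odd, map_sub, map_add,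
    map_pow, map_pow, aeval_X, Even.neg_pow ⟨6 * (s + 1), by ring⟩,
    Even.neg_pow ⟨6 * (s + 1) + 1, by ring⟩, T_pow, T_pow]
  set F := (List.ofFn fun i => TwistBlock.high (exponents s i) (exponents s i)).prod.trace
  change _ * (_ + _ * (_ * aeval (-T (-4) : ℤ[T;T⁻¹]) F)) = _
  have e1 : (T (36 * (s + 1)) * T 4 * T (-12 * (s + 1)) : ℤ[T;T⁻¹]) =
      T (72 * (s + 1) + 4) * T ((12 * (s + 1) : ℕ) * -4) := by
    simp only [← T_add]; congr 1; push_cast; ring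
  have e2 : (T (36 * (s + 1)) * T (-4) * T (-12 * (s + 1)) : ℤ[T;T⁻¹]) =
      T (72 * (s + 1) + 4) * T ((12 * (s + 1) + 2 : ℕ) * -4) := by
    simp only [← T_add]; congr 1; push_cast; ring
  have e3 : (T (36 * (s + 1)) * T (12 * (s + 1)) * T ((6 * (s + 1) + 1) * 4) : ℤ[T;T⁻¹]) =
      T (72 * (s + 1) + 4) := by
    simp only [← T_add]; congr 1; ring
  linear_combination e1 + e2 - aeval (-T (-4) : ℤ[T;T⁻¹]) F * e3

end BraidWord

/-! ### The extremal coefficients. -/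

open BraidWord Polynomial in
theorem proposition6p7 (s : ℕ) (hs : 1 < s) :
    ∃ (k : ℤ) (p q : Fin s → ℕ),
      (∀ i, 0 < p i ∧ 0 < q i) ∧
      (genericWord k p q).ClosureIsKnot ∧
      ∃ β β' : ℤ,
        IsSecondCoeff (genericWord k p q).jones β ∧
        IsNextToLastCoeff (genericWord k p q).jones β' ∧
        (β : ℚ) = -((s : ℚ) * ((s : ℚ) + 3)) / 2 + 1 ∧
        β' = (s : ℤ) := by
  -- From here on the number of blocks is `s + 1`.
  obtain ⟨s, rfl⟩ : ∃ m, s = m + 1 := ⟨s - 1, by omega⟩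
  have hpos : ∀ i, 0 < exponents s i := fun i => (le_exponents s i).trans_lt' (by norm_num)
  have h3 : ∀ i, 3 ≤ exponents s i := fun i => (le_exponents s i).trans' (by norm_num)
  have h2 : ∀ i, 2 ≤ exponents s i := fun i => (le_exponents s i).trans' (by norm_num)
  obtain ⟨q0, q1, q2⟩ := TwistBlock.coeff_quadratic_pow (s + 1)
  refine ⟨_, exponents s, exponents s, fun i => ⟨hpos i, hpos i⟩, closureIsKnot_knotWord s,
    _, _, isSecondCoeff_of_normalizedBracket_eq _ _ _ (normalizedBracket_knotWord_eq_low s) ?_ ?_,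
    isNextToLastCoeff_of_normalizedBracket_eq _ _ _ (normalizedBracket_knotWord_eq_high s) ?_,
    ?_, ?_⟩
  · rw [coeff_sub, TwistBlock.coeff_trace_low _ _ h3 h3 (by norm_num), q0]
    simp
  · rw [coeff_sub, TwistBlock.coeff_trace_low _ _ h3 h3 (by norm_num), q1]
    simp [coeff_one, coeff_X_pow]
    omega
  · rw [coeff_sub, TwistBlock.coeff_trace_high _ _ h2 h2 (by norm_num)]
    simp [coeff_zero_eq_eval_zero]
  · rw [coeff_sub, TwistBlock.coeff_trace_low _ _ h3 h3 (by norm_num)]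
    have q2' : (2 : ℚ) * (((1 + X + 2 * X ^ 2 : ℤ[X]) ^ (s + 1)).coeff 2 : ℤ) =
        (s + 1 : ℕ) * ((s + 1 : ℕ) + 3) := by exact_mod_cast q2
    have c2 : (1 + X ^ 2 : ℤ[X]).coeff 2 = 1 := by simp [coeff_one]
    rw [c2]
    push_cast at q2' ⊢
    linarith
  · rw [coeff_sub, TwistBlock.coeff_trace_high _ _ h2 h2 (by norm_num)]
    rw [coeff_one_add_X_pow, coeff_add, coeff_X_pow, coeff_X_pow, if_neg (by omega),
      if_neg (by omega)]
    simp
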